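/- For $n\ge 1$ and $\theta\in\mathbb R^n$ let $\mathbb E_\theta$ denote expectation under $X\sim N(\theta,I_n)$. For a non-empty closed convex set $\Theta\subseteq\mathbb R^n$ let $\mathcal F(\Theta)$ be the class of real-valued convex functions $f$ on $\Theta$ that are bounded below on $\Theta$ and for which the minimum of $\alpha\mapsto\frac12\|x-\alpha\|_2^2+f(\alpha)$ over $\Theta$ is attained for every $x\in\mathbb R^n$ (the latter holds, for instance, when $f$ is lower semicontinuous on $\Theta$). For $f\in\mathcal F(\Theta)$ let $$\widehat\theta(X;\Theta,f):=\operatorname*{argmin}_{\alpha\in\Theta}\Big(\tfrac12\|X-\alpha\|_2^2+f(\alpha)\Big)$$ be the penalized least squares estimator, and define the normalized minimax risk $$R_{\mathrm{nm}}(\Theta;f):=\inf_{\delta}\ \sup_{\theta\in\Theta}\ \frac{\mathbb E_\theta\|\delta(X)-\theta\|_2^2}{\mathbb E_\theta\|\widehat\theta(X;\Theta,f)-\theta\|_2^2},$$ where the infimum is over all estimators, i.e. measurable maps $\delta:\mathbb R^n\to\mathbb R^n$, with the conventions $\frac00=1$ and $\frac a0=+\infty$ for $a>0$. Let $$C^*:=\inf_{n\ge1}\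 \inf_{\Theta}\ \inf_{f\in\mathcal F(\Theta)}R_{\mathrm{nm}}(\Theta;f),$$ where $\Theta$ ranges over all non-empty closed convex subsets of $\mathbb R^n$. Then $$6.05\times10^{-6}\ \le\ C^*\ \le\ \tfrac12 .$$ -/

import Mathlib

open MeasureTheory ProbabilityTheory
open scoped ENNReal

noncomputable section

namespace GaussianSequence

/-- The law `N(θ, Iₙ)` of the observation `X`. -/
def law {n : ℕ} (θ : EuclideanSpace ℝ (Fin n)) : Measure (EuclideanSpace ℝ (Fin n)) :=
  multivariateGaussian θ 1

/-- The risk `E_θ ‖δ(X) - θ‖²`, with values in `[0, ∞]`. -/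
def risk {n : ℕ} (δ : EuclideanSpace ℝ (Fin n) → EuclideanSpace ℝ (Fin n))
    (θ : EuclideanSpace ℝ (Fin n)) : ℝ≥0∞ :=
  ∫⁻ x, ‖δ x - θ‖ₑ ^ 2 ∂(law θ)

/-- `a` minimizes `α ↦ ‖x - α‖² / 2 + f α` over `Θ`. -/
def IsPenalizedMin {n : ℕ} (Θ : Set (EuclideanSpace ℝ (Fin n)))
    (f : EuclideanSpace ℝ (Fin n) → ℝ) (x a : EuclideanSpace ℝ (Fin n)) : Prop :=
  a ∈ Θ ∧ IsMinOn (fun α => 1 / 2 * ‖x - α‖ ^ 2 + f α) Θ a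

/-- The closed convex parameter sets in `ℝⁿ` (non-empty, as parameter sets are). -/
def parameterSets (n : ℕ) : Set (Set (EuclideanSpace ℝ (Fin n))) :=
  {Θ | IsClosed Θ ∧ Convex ℝ Θ ∧ Θ.Nonempty}

/-- The convex penalties on `Θ` (only the values on `Θ` matter): real-valued convex functions on
`Θ`, bounded below on `Θ`, for which the penalized least squares problem has a solution for every
observation `x` (automatic, for instance, if `f` is lower semicontinuous on `Θ`). -/
def penalties {n : ℕ} (Θ : Set (EuclideanSpace ℝ (Fin n))) :
    Set (EuclideanSpace ℝ (Fin n) → ℝ) :=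
  {f | ConvexOn ℝ Θ f ∧ BddBelow (f '' Θ) ∧ ∀ x, ∃ a, IsPenalizedMin Θ f x a}

open Classical in
/-- The penalized least squares estimator, `argmin_{α ∈ Θ} (‖x - α‖² / 2 + f α)`. For
`f ∈ penalties Θ` the minimizer exists and, by strict convexity, is unique. -/
def penalizedLSE {n : ℕ} (Θ : Set (EuclideanSpace ℝ (Fin n)))
    (f : EuclideanSpace ℝ (Fin n) → ℝ) (x : EuclideanSpace ℝ (Fin n)) :
    EuclideanSpace ℝ (Fin n) :=
  if h : ∃ a, IsPenalizedMin Θ f x a then h.choose else 0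

open Classical in
/-- Quotient of risks with the conventions `0 / 0 = 1` and `a / 0 = ∞` for `a > 0`. -/
def riskRatio (r s : ℝ≥0∞) : ℝ≥0∞ :=
  if r = 0 ∧ s = 0 then 1 else r / s

/-- The normalized minimax risk over `Θ`; estimators are the measurable maps `ℝⁿ → ℝⁿ`. -/
def normalizedMinimaxRisk {n : ℕ} (Θ : Set (EuclideanSpace ℝ (Fin n)))
    (f : EuclideanSpace ℝ (Fin n) → ℝ) : ℝ≥0∞ :=
  ⨅ (δ : EuclideanSpace ℝ (Fin n) → EuclideanSpace ℝ (Fin n)) (_ : Measurable δ),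
    ⨆ θ ∈ Θ, riskRatio (risk δ θ) (risk (penalizedLSE Θ f) θ)

/-- The universal constant `C*`. -/
def Cstar : ℝ≥0∞ :=
  ⨅ (n : ℕ) (_ : 1 ≤ n), ⨅ Θ ∈ parameterSets n, ⨅ f ∈ penalties Θ, normalizedMinimaxRisk Θ f

end GaussianSequence

end

/-!
**Lower bound.** A penalized least squares estimator `T` is a proximal map, hence firmly
nonexpansive. Write `T̄ θ` for the mean of `T` under `N(θ, I)`. Since `Θ` is convex and `f` bounded
below, iterating `T̄` decreases a smoothed objective and yields `θ₀ ∈ Θ` where the bias `T̄ θ₀ - θ₀`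
is as small as we please. Let `r ^ 2` be the risk of `T` at `θ₀`; because `T` moves little with the
parameter, its risk at `θ` is at most `2 * r ^ 2 + 2 * ‖θ - θ₀‖ ^ 2`.

* If `r` is bounded, some point of `Θ` lies at distance `min 1 r` from `θ₀`, and no estimator can
  tell these two parameters apart.
* If `r` is large, take as prior the law under `N(θ₀, I)` of `θ₀ + (T - θ₀) / 12`. Since the bias is
  small, `‖T - b‖ ^ 2` has mean at least `r ^ 2 - 1` for every `b`, so by Gaussian concentration the
  prior gives every ball of radius `r / 24` mass at most `exp (-0.032 * r ^ 2)`. An estimator of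
  small risk would, after a change of measure to `θ₀` costing only `exp (-r ^ 2 / 36)`, be within
  `r / 24` of the drawn parameter too often.

**Upper bound.** On `Θ = [-a, a]` with `f = 0`, the estimator rounds almost every observation to
`±a` when `a` is small, so its risk at `θ` is nearly `a ^ 2 + θ ^ 2 ≥ 2 * θ ^ 2`, twice the risk of
the zero estimator.
-/

namespace GaussianSequence

open Real
open scoped NNReal RealInnerProductSpace

section Density

variable {ι : Type*} [Fintype ι] {E : Type*} [NormedAddCommGroup E] [InnerProductSpace ℝ E]

lemma pi_gaussianReal_eq_withDensity :
    Measure.pi (fun _ : ι ↦ gaussianReal 0 1) =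
      volume.withDensity (fun x ↦ ENNReal.ofReal (∏ i, gaussianPDFReal 0 1 (x i))) := by
  refine Measure.pi_eq fun s hs ↦ ?_
  have hnonneg (x : ι → ℝ) : 0 ≤ ∏ i, gaussianPDFReal 0 1 (x i) :=
    Finset.prod_nonneg fun i _ ↦ gaussianPDFReal_nonneg _ _ _
  rw [withDensity_apply _ (MeasurableSet.univ_pi hs), volume_pi, Measure.restrict_pi_pi,
    ← ofReal_integral_eq_lintegral_ofReal
      (Integrable.fintype_prod fun i ↦ (integrable_gaussianPDFReal 0 1).restrict)
      (.of_forall hnonneg),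
    integral_fintype_prod_eq_prod (f := fun _ x ↦ gaussianPDFReal 0 1 x),
    ENNReal.ofReal_prod_of_nonneg
      fun i _ ↦ integral_nonneg fun x ↦ gaussianPDFReal_nonneg _ _ _]
  exact Finset.prod_congr rfl fun i _ ↦ (gaussianReal_apply_eq_integral _ one_ne_zero _).symm

/-- The density of the standard Gaussian measure of a Euclidean space with respect to its
Lebesgue measure. -/
noncomputable def stdGaussianPDFReal (x : E) : ℝ :=
  (√(2 * π))⁻¹ ^ Module.finrank ℝ E * exp (-‖x‖ ^ 2 / 2)

lemma stdGaussianPDFReal_nonneg (x : E) : 0 ≤ stdGaussianPDFReal x := by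
  unfold stdGaussianPDFReal; positivity

lemma stdGaussianPDFReal_repr_symm (b : OrthonormalBasis ι ℝ E) (x : ι → ℝ) :
    stdGaussianPDFReal (b.repr.symm (WithLp.toLp 2 x)) = ∏ i, gaussianPDFReal 0 1 (x i) := by
  simp [stdGaussianPDFReal, gaussianPDFReal, Finset.prod_mul_distrib, ← exp_sum,
    EuclideanSpace.real_norm_sq_eq, Finset.sum_neg_distrib, Finset.sum_div, neg_div,
    Module.finrank_eq_card_basis b.toBasis]

/-- The likelihood ratio at `z` of the Gaussian shift by `h` with respect to the standard Gaussian
measure. -/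
noncomputable def likelihood (h z : E) : ℝ := exp (⟪h, z⟫ - ‖h‖ ^ 2 / 2)

lemma likelihood_nonneg (h z : E) : 0 ≤ likelihood h z := (exp_pos _).le

lemma stdGaussianPDFReal_mul_likelihood (h z : E) :
    stdGaussianPDFReal z * likelihood h z = stdGaussianPDFReal (z - h) := by
  rw [stdGaussianPDFReal, stdGaussianPDFReal, likelihood, mul_assoc, ← exp_add,
    norm_sub_sq_real, real_inner_comm]
  ring_nf

variable [MeasurableSpace E] [BorelSpace E]

@[fun_prop]
lemma measurable_stdGaussianPDFReal : Measurable (stdGaussianPDFReal (E := E)) := by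
  unfold stdGaussianPDFReal; fun_prop

@[fun_prop]
lemma measurable_likelihood (h : E) : Measurable (likelihood h) := by
  unfold likelihood; fun_prop

variable [FiniteDimensional ℝ E]

lemma stdGaussian_eq_withDensity :
    stdGaussian E = volume.withDensity (fun x ↦ ENNReal.ofReal (stdGaussianPDFReal x)) := by
  let b := stdOrthonormalBasis ℝ E
  have hmp : MeasurePreserving (b.repr.symm ∘ WithLp.toLp 2) :=
    b.measurePreserving_repr_symm.comp (PiLp.volume_preserving_toLp _)
  rw [← stdGaussian_map b.repr.symm, ← map_pi_eq_stdGaussian,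
    Measure.map_map (by fun_prop) (by fun_prop), pi_gaussianReal_eq_withDensity]
  ext s hs
  rw [Measure.map_apply hmp.measurable hs, withDensity_apply _ hs,
    withDensity_apply _ (hmp.measurable hs),
    ← hmp.setLIntegral_comp_preimage hs (by fun_prop)]
  simp_rw [Function.comp_apply, stdGaussianPDFReal_repr_symm]

lemma lintegral_stdGaussian {g : E → ℝ≥0∞} (hg : Measurable g) :
    ∫⁻ z, g z ∂stdGaussian E = ∫⁻ z, ENNReal.ofReal (stdGaussianPDFReal z) * g z := by
  rw [stdGaussian_eq_withDensity, lintegral_withDensity_eq_lintegral_mul _ (by fun_prop) hg]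
  rfl

lemma stdGaussian_absolutelyContinuous : stdGaussian E ≪ volume := by
  rw [stdGaussian_eq_withDensity]
  exact withDensity_absolutelyContinuous _ _

lemma lintegral_stdGaussian_add (h : E) {g : E → ℝ≥0∞} (hg : Measurable g) :
    ∫⁻ z, g (h + z) ∂stdGaussian E =
      ∫⁻ z, ENNReal.ofReal (likelihood h z) * g z ∂stdGaussian E := by
  rw [lintegral_stdGaussian (by fun_prop), lintegral_stdGaussian (by fun_prop),
    ← lintegral_add_left_eq_self (fun z ↦ ENNReal.ofReal (stdGaussianPDFReal z) *
      (ENNReal.ofReal (likelihood h z) * g z)) h]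
  refine lintegral_congr fun z ↦ ?_
  rw [← mul_assoc, ← ENNReal.ofReal_mul (stdGaussianPDFReal_nonneg _),
    stdGaussianPDFReal_mul_likelihood, add_sub_cancel_left]

lemma lintegral_likelihood (h : E) :
    ∫⁻ z, ENNReal.ofReal (likelihood h z) ∂stdGaussian E = 1 := by
  simpa using (lintegral_stdGaussian_add h (g := fun _ ↦ 1) measurable_const).symm

lemma lintegral_exp_inner (h : E) :
    ∫⁻ z, ENNReal.ofReal (exp ⟪h, z⟫) ∂stdGaussian E = ENNReal.ofReal (exp (‖h‖ ^ 2 / 2)) := by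
  have hexp (z : E) : exp ⟪h, z⟫ = exp (‖h‖ ^ 2 / 2) * likelihood h z := by
    rw [likelihood, ← exp_add, add_sub_cancel]
  simp_rw [hexp, ENNReal.ofReal_mul (exp_pos _).le]
  rw [lintegral_const_mul _ (by fun_prop), lintegral_likelihood, mul_one]

lemma lintegral_likelihood_sq (h : E) :
    ∫⁻ z, ENNReal.ofReal (likelihood h z ^ 2) ∂stdGaussian E =
      ENNReal.ofReal (exp (‖h‖ ^ 2)) := by
  have hsq (z : E) : likelihood h z ^ 2 = exp (-‖h‖ ^ 2) * exp ⟪(2 : ℝ) • h, z⟫ := by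
    rw [likelihood, ← exp_nat_mul, ← exp_add, real_inner_smul_left]
    ring_nf
  simp_rw [hsq, ENNReal.ofReal_mul (exp_pos _).le]
  rw [lintegral_const_mul _ (by fun_prop), lintegral_exp_inner, ← ENNReal.ofReal_mul (exp_pos _).le,
    ← exp_add, norm_smul, Real.norm_ofNat]
  ring_nf

end Density

section SubGaussian

variable {Ω : Type*} {mΩ : MeasurableSpace Ω} {μ : Measure Ω} {X : Ω → ℝ} {c : ℝ≥0}

lemma hasSubgaussianMGF_of_lintegral_le (hX : AEMeasurable X μ)
    (h : ∀ t, ∫⁻ ω, ENNReal.ofReal (exp (t * X ω)) ∂μ ≤ ENNReal.ofReal (exp (c * t ^ 2 / 2))) :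
    HasSubgaussianMGF X c μ where
  integrable_exp_mul t := by
    refine ⟨(measurable_exp.comp_aemeasurable (hX.const_mul t)).aestronglyMeasurable, ?_⟩
    rw [hasFiniteIntegral_iff_ofReal (.of_forall fun ω ↦ (exp_pos _).le)]
    exact (h t).trans_lt ENNReal.ofReal_lt_top
  mgf_le t := by
    rw [mgf, integral_eq_lintegral_of_nonneg_ae (.of_forall fun ω ↦ (exp_pos _).le)
      (measurable_exp.comp_aemeasurable (hX.const_mul t)).aestronglyMeasurable]
    exact ENNReal.toReal_le_of_le_ofReal (exp_pos _).le (h t)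

lemma integrable_exp_mul_of_hasSubgaussianMGF_sub [IsProbabilityMeasure μ]
    (h : HasSubgaussianMGF (fun p : Ω × Ω ↦ X p.2 - X p.1) c (μ.prod μ)) (t : ℝ) :
    Integrable (fun ω ↦ exp (t * X ω)) μ := by
  obtain ⟨ω₀, hω₀⟩ := (h.integrable_exp_mul t).prod_right_ae.exists
  refine (hω₀.const_mul (exp (t * X ω₀))).congr (.of_forall fun ω ↦ ?_)
  simp only [← exp_add]
  ring_nf

lemma hasSubgaussianMGF_sub_integral [IsProbabilityMeasure μ]
    (h : HasSubgaussianMGF (fun p : Ω × Ω ↦ X p.2 - X p.1) c (μ.prod μ)) :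
    HasSubgaussianMGF (fun ω ↦ X ω - ∫ ω', X ω' ∂μ) c μ := by
  have hexp := integrable_exp_mul_of_hasSubgaussianMGF_sub h
  have hX : Integrable X μ := by
    simpa using integrable_pow_of_integrable_exp_mul one_ne_zero (hexp 1) (hexp (-1)) 1
  have hsplit (t : ℝ) (ω : Ω) : exp (t * (X ω - ∫ ω', X ω' ∂μ)) =
      exp (-t * ∫ ω', X ω' ∂μ) * exp (t * X ω) := by
    rw [← exp_add]; ring_nf
  refine ⟨fun t ↦ by simpa only [hsplit] using (hexp t).const_mul _, fun t ↦ ?_⟩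
  have hJensen : exp (-t * ∫ ω, X ω ∂μ) ≤ mgf X μ (-t) := by
    rw [← integral_const_mul]
    exact convexOn_exp.map_integral_le continuous_exp.continuousOn isClosed_univ
      (.of_forall fun _ ↦ Set.mem_univ _) (hX.const_mul _) (hexp (-t))
  calc mgf (fun ω ↦ X ω - ∫ ω', X ω' ∂μ) μ t = exp (-t * ∫ ω, X ω ∂μ) * mgf X μ t := by
        simp only [mgf, hsplit, integral_const_mul]
    _ ≤ mgf X μ (-t) * mgf X μ t := by gcongr; exact mgf_nonneg
    _ = mgf (fun p : Ω × Ω ↦ X p.2 - X p.1) (μ.prod μ) t := by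
        rw [mgf, mgf, mgf, ← integral_prod_mul]
        exact integral_congr_ae (.of_forall fun p ↦ by simp only [← exp_add]; ring_nf)
    _ ≤ exp (c * t ^ 2 / 2) := h.mgf_le t

lemma one_add_sq_div_two_le_cosh (x : ℝ) : 1 + x ^ 2 / 2 ≤ cosh x := by
  have hsinh : (x / 2) ^ 2 ≤ sinh (x / 2) ^ 2 :=
    sq_le_sq.2 (by rw [abs_sinh]; exact self_le_sinh_iff.2 (abs_nonneg _))
  have hcosh : cosh x = cosh (x / 2) ^ 2 + sinh (x / 2) ^ 2 := by
    rw [← cosh_two_mul, mul_div_cancel₀ _ two_ne_zero]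
  linarith [cosh_sq (x / 2)]

lemma sq_mul_integral_sq_le_of_hasSubgaussianMGF [IsProbabilityMeasure μ]
    (h : HasSubgaussianMGF X c μ) (t : ℝ) :
    t ^ 2 / 2 * ∫ ω, X ω ^ 2 ∂μ ≤ exp (c * t ^ 2 / 2) - 1 := by
  have hexp := h.integrable_exp_mul
  have hcosh (ω : Ω) : t ^ 2 / 2 * X ω ^ 2 ≤ (exp (t * X ω) + exp (-t * X ω)) / 2 - 1 := by
    have := one_add_sq_div_two_le_cosh (t * X ω)
    rw [cosh_eq, ← neg_mul] at this
    linarith [mul_pow t (X ω) 2]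
  have hint : Integrable (fun ω ↦ (exp (t * X ω) + exp (-t * X ω)) / 2) μ :=
    ((hexp t).add (hexp (-t))).div_const 2
  calc t ^ 2 / 2 * ∫ ω, X ω ^ 2 ∂μ
      ≤ ∫ ω, ((exp (t * X ω) + exp (-t * X ω)) / 2 - 1) ∂μ := by
        rw [← integral_const_mul]
        exact integral_mono_of_nonneg (.of_forall fun ω ↦ by positivity)
          (hint.sub (integrable_const 1)) (.of_forall hcosh)
    _ = (mgf X μ t + mgf X μ (-t)) / 2 - 1 := by
        rw [integral_sub hint (integrable_const 1), integral_div,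
          integral_add (hexp t) (hexp (-t)), mgf, mgf]
        simp
    _ ≤ exp (c * t ^ 2 / 2) - 1 := by
        have := h.mgf_le (-t)
        rw [neg_sq] at this
        linarith [h.mgf_le t]

lemma integral_sq_le_of_hasSubgaussianMGF [IsProbabilityMeasure μ]
    (h : HasSubgaussianMGF X c μ) : ∫ ω, X ω ^ 2 ∂μ ≤ c := by
  have hderiv : HasDerivAt (fun u : ℝ ↦ exp (c * u)) c 0 := by
    simpa using ((hasDerivAt_id (0 : ℝ)).const_mul (c : ℝ)).exp
  refine ge_of_tendsto hderiv.tendsto_slope_zero_right ?_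
  filter_upwards [self_mem_nhdsWithin] with u (hu : 0 < u)
  have hsq := sq_mul_integral_sq_le_of_hasSubgaussianMGF h √(2 * u)
  rw [mul_div_assoc, sq_sqrt (by positivity), mul_div_cancel_left₀ _ two_ne_zero] at hsq
  simpa [le_inv_mul_iff₀ hu] using hsq

end SubGaussian

lemma ofReal_exp_sub_le_setLAverage_deriv {φ : ℝ → ℝ} {K : ℝ≥0} (hφ : LipschitzWith K φ) {a b : ℝ}
    (hab : a < b) :
    ENNReal.ofReal (exp (φ b - φ a)) ≤
      ⨍⁻ t in Set.Ioc a b, ENNReal.ofReal (exp ((b - a) * deriv φ t)) ∂volume := by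
  have hbound (t : ℝ) : ‖(b - a) * deriv φ t‖ ≤ (b - a) * K := by
    rw [norm_mul, Real.norm_of_nonneg (sub_nonneg.2 hab.le)]
    exact mul_le_mul_of_nonneg_left (norm_deriv_le_of_lipschitz hφ) (sub_nonneg.2 hab.le)
  have hmeas : Measurable (fun t ↦ (b - a) * deriv φ t) := (measurable_deriv φ).const_mul _
  have hint : IntegrableOn (fun t ↦ (b - a) * deriv φ t) (Set.Ioc a b) :=
    Measure.integrableOn_of_bounded (by simp) hmeas.aestronglyMeasurable (.of_forall hbound)
  have hint_exp : IntegrableOn (fun t ↦ exp ((b - a) * deriv φ t)) (Set.Ioc a b) := by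
    refine Measure.integrableOn_of_bounded (M := exp ((b - a) * K)) (by simp)
      (measurable_exp.comp hmeas).aestronglyMeasurable (.of_forall fun t ↦ ?_)
    rw [Real.norm_of_nonneg (exp_pos _).le]
    exact exp_le_exp.2 ((le_abs_self _).trans (hbound t))
  have haverage : ⨍ t in Set.Ioc a b, (b - a) * deriv φ t = φ b - φ a := by
    have hftc : ∫ t in a..b, deriv φ t = φ b - φ a :=
      hφ.lipschitzOnWith.absolutelyContinuousOnInterval.integral_deriv_eq_sub
    rw [intervalIntegral.integral_of_le hab.le] at hftc
    rw [setAverage_eq, integral_const_mul, hftc, Real.volume_real_Ioc_of_le hab.le, smul_eq_mul,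
      inv_mul_cancel_left₀ (sub_pos.2 hab).ne']
  rw [← haverage, setLAverage_eq, ← ofReal_setAverage hint_exp (.of_forall fun t ↦ (exp_pos _).le)]
  refine ENNReal.ofReal_le_ofReal ?_
  exact convexOn_exp.map_set_average_le continuous_exp.continuousOn isClosed_univ (by simp [hab])
    (by simp) (.of_forall fun _ ↦ Set.mem_univ _) hint hint_exp

section Rotation

variable {V : Type*} [NormedAddCommGroup V] [NormedSpace ℝ V]

lemma hasDerivAt_rotation_fst (p : V × V) (t : ℝ) :
    HasDerivAt (fun t ↦ (ContinuousLinearMap.rotation t p).1)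
      (ContinuousLinearMap.rotation t p).2 t := by
  simpa only [ContinuousLinearMap.rotation_apply] using
    ((hasDerivAt_cos t).smul_const p.1).fun_add ((hasDerivAt_sin t).smul_const p.2)

lemma lipschitzWith_rotation_fst (p : V × V) :
    LipschitzWith (‖p.1‖₊ + ‖p.2‖₊) (fun t ↦ (ContinuousLinearMap.rotation t p).1) := by
  refine lipschitzWith_of_nnnorm_deriv_le (fun t ↦ (hasDerivAt_rotation_fst p t).differentiableAt)
    fun t ↦ ?_
  rw [(hasDerivAt_rotation_fst p t).deriv, ContinuousLinearMap.rotation_apply]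
  refine (nnnorm_add_le _ _).trans ?_
  rw [nnnorm_smul, nnnorm_smul, nnnorm_neg]
  gcongr
  · exact mul_le_of_le_one_left' (abs_sin_le_one t)
  · exact mul_le_of_le_one_left' (abs_cos_le_one t)

lemma continuous_rotation :
    Continuous (fun q : (V × V) × ℝ ↦ ContinuousLinearMap.rotation q.2 q.1) := by
  simp only [ContinuousLinearMap.rotation_apply]; fun_prop

end Rotation

section Concentration

variable {E : Type*} [NormedAddCommGroup E] [InnerProductSpace ℝ E] [FiniteDimensional ℝ E]
  [MeasurableSpace E] [BorelSpace E] {F : E → ℝ} {K : ℝ≥0}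

lemma map_rotation_stdGaussian_prod (t : ℝ) :
    ((stdGaussian E).prod (stdGaussian E)).map (ContinuousLinearMap.rotation t) =
      (stdGaussian E).prod (stdGaussian E) :=
  IsGaussian.map_rotation_eq_self_of_forall_strongDual_eq_zero integral_strongDual_stdGaussian t

lemma ae_ae_differentiableAt_rotation_fst (hF : LipschitzWith K F) :
    ∀ᵐ p ∂(stdGaussian E).prod (stdGaussian E),
      ∀ᵐ t : ℝ, DifferentiableAt ℝ F (ContinuousLinearMap.rotation t p).1 := by
  rw [Measure.ae_ae_comm (p := fun p t ↦ DifferentiableAt ℝ F (ContinuousLinearMap.rotation t p).1)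
    ((measurable_fst.comp continuous_rotation.measurable)
      (measurableSet_of_differentiableAt ℝ F))]
  refine .of_forall fun t ↦ ?_
  have hae : ∀ᵐ p ∂(stdGaussian E).prod (stdGaussian E), DifferentiableAt ℝ F p.1 :=
    Measure.quasiMeasurePreserving_fst.ae
      (stdGaussian_absolutelyContinuous.ae_le hF.ae_differentiableAt)
  rw [← map_rotation_stdGaussian_prod t] at hae
  exact ae_of_ae_map (p := fun q ↦ DifferentiableAt ℝ F q.1)
    (ContinuousLinearMap.rotation t).continuous.aemeasurable hae

lemma ae_ofReal_exp_mul_sub_le_setLAverage (hF : LipschitzWith K F) (c : ℝ) :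
    ∀ᵐ p ∂(stdGaussian E).prod (stdGaussian E),
      ENNReal.ofReal (exp (c * (F p.2 - F p.1))) ≤ ⨍⁻ t in Set.Ioc 0 (π / 2),
        ENNReal.ofReal (exp (π / 2 * c * fderiv ℝ F (ContinuousLinearMap.rotation t p).1
          (ContinuousLinearMap.rotation t p).2)) ∂volume := by
  filter_upwards [ae_ae_differentiableAt_rotation_fst hF] with p hp
  have hφ : LipschitzWith (‖c‖₊ * (K * (‖p.1‖₊ + ‖p.2‖₊)))
      (fun t ↦ c * F (ContinuousLinearMap.rotation t p).1) :=
    (lipschitzWith_smul c).comp (hF.comp (lipschitzWith_rotation_fst p))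
  have hJensen := ofReal_exp_sub_le_setLAverage_deriv hφ (a := 0) (b := π / 2) (by positivity)
  simp only [ContinuousLinearMap.rotation_apply (π / 2), ContinuousLinearMap.rotation_apply 0,
    cos_pi_div_two, sin_pi_div_two, cos_zero, sin_zero, zero_smul, one_smul, zero_add, add_zero,
    sub_zero, ← mul_sub] at hJensen
  refine hJensen.trans_eq (laverage_congr (ae_restrict_of_ae ?_))
  filter_upwards [hp] with t ht
  have hderiv := (ht.hasFDerivAt.comp_hasDerivAt t (hasDerivAt_rotation_fst p t)).const_mul c
  rw [mul_assoc, ← hderiv.deriv]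
  rfl

lemma lintegral_exp_mul_fderiv_le (hF : LipschitzWith K F) (c : ℝ) (x : E) :
    ∫⁻ y, ENNReal.ofReal (exp (c * fderiv ℝ F x y)) ∂stdGaussian E ≤
      ENNReal.ofReal (exp ((c * K) ^ 2 / 2)) := by
  let g := (InnerProductSpace.toDual ℝ E).symm (fderiv ℝ F x)
  have hg : ‖g‖ ≤ K := by
    rw [LinearIsometryEquiv.norm_map]; exact norm_fderiv_le_of_lipschitz ℝ hF
  have hinner (y : E) : c * fderiv ℝ F x y = ⟪c • g, y⟫ := by
    rw [real_inner_smul_left, InnerProductSpace.toDual_symm_apply]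
  simp_rw [hinner]
  rw [lintegral_exp_inner, norm_smul, mul_pow, mul_pow, Real.norm_eq_abs, sq_abs]
  gcongr

/-- Maurey and Pisier: rotate `p.1` into `p.2` along a quarter circle. At each time the position
and the velocity are independent standard Gaussian vectors, so conditionally on the position the
derivative of `F` along the path is Gaussian. -/
lemma lintegral_exp_mul_sub_le (hF : LipschitzWith K F) (c : ℝ) :
    ∫⁻ p, ENNReal.ofReal (exp (c * (F p.2 - F p.1))) ∂(stdGaussian E).prod (stdGaussian E) ≤
      ENNReal.ofReal (exp ((π / 2 * c * K) ^ 2 / 2)) := by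
  let H : E × E → ℝ≥0∞ := fun p ↦ ENNReal.ofReal (exp (π / 2 * c * fderiv ℝ F p.1 p.2))
  have hH : Measurable H := by
    have : Measurable (fun p : E × E ↦ fderiv ℝ F p.1 p.2) :=
      ContinuousLinearMap.measurable_apply₂.comp
        (((measurable_fderiv ℝ F).comp measurable_fst).prodMk measurable_snd)
    fun_prop
  calc _ ≤ ∫⁻ p, ⨍⁻ t in Set.Ioc 0 (π / 2), H (ContinuousLinearMap.rotation t p) ∂volume
        ∂(stdGaussian E).prod (stdGaussian E) :=
      lintegral_mono_ae (ae_ofReal_exp_mul_sub_le_setLAverage hF c)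
    _ = ⨍⁻ t in Set.Ioc 0 (π / 2), ∫⁻ p, H (ContinuousLinearMap.rotation t p)
        ∂(stdGaussian E).prod (stdGaussian E) ∂volume :=
      lintegral_lintegral_swap (hH.comp continuous_rotation.measurable).aemeasurable
    _ = ⨍⁻ _ in Set.Ioc 0 (π / 2), ∫⁻ x, ∫⁻ y, H (x, y) ∂stdGaussian E ∂stdGaussian E ∂volume := by
      refine congrArg _ (funext fun t ↦ ?_)
      rw [← lintegral_map hH (by fun_prop), map_rotation_stdGaussian_prod t,
        lintegral_prod _ hH.aemeasurable]
    _ = ∫⁻ x, ∫⁻ y, H (x, y) ∂stdGaussian E ∂stdGaussian E :=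
      setLAverage_const (by simp [pi_pos]) (by simp) _
    _ ≤ ∫⁻ _, ENNReal.ofReal (exp ((π / 2 * c * K) ^ 2 / 2)) ∂stdGaussian E :=
      lintegral_mono fun x ↦ lintegral_exp_mul_fderiv_le hF (π / 2 * c) x
    _ = ENNReal.ofReal (exp ((π / 2 * c * K) ^ 2 / 2)) := by simp

lemma hasSubgaussianMGF_stdGaussian_of_lipschitzWith (hF : LipschitzWith K F) :
    HasSubgaussianMGF (fun z ↦ F z - ∫ z', F z' ∂stdGaussian E) ((NNReal.pi / 2 * K) ^ 2)
      (stdGaussian E) := by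
  have hFm : Measurable F := hF.continuous.measurable
  refine hasSubgaussianMGF_sub_integral (hasSubgaussianMGF_of_lintegral_le (by fun_prop) fun t ↦ ?_)
  refine (lintegral_exp_mul_sub_le hF t).trans_eq ?_
  push_cast
  rw [NNReal.coe_real_pi]
  ring_nf

lemma memLp_stdGaussian_of_lipschitzWith {V : Type*} [NormedAddCommGroup V] {T : E → V}
    (hT : LipschitzWith K T) (p : ℝ≥0) : MemLp T p (stdGaussian E) := by
  have hid : MemLp (fun z : E ↦ ‖T 0‖ + K * ‖z‖) p (stdGaussian E) :=
    (memLp_const ‖T 0‖).add ((IsGaussian.memLp_id _ p ENNReal.coe_ne_top).norm.const_mul K)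
  refine hid.mono' hT.continuous.aestronglyMeasurable (.of_forall fun z ↦ ?_)
  have := hT.dist_le_mul z 0
  rw [dist_zero_right, dist_eq_norm] at this
  linarith [norm_le_norm_add_norm_sub' (T z) (T 0)]

lemma variance_stdGaussian_le_of_lipschitzWith (hF : LipschitzWith K F) :
    Var[F; stdGaussian E] ≤ (π / 2 * K) ^ 2 := by
  rw [variance_eq_integral hF.continuous.measurable.aemeasurable]
  exact integral_sq_le_of_hasSubgaussianMGF (hasSubgaussianMGF_stdGaussian_of_lipschitzWith hF)

lemma measureReal_stdGaussian_le_sub_le (hF : LipschitzWith K F) {t : ℝ} (ht : 0 ≤ t) :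
    (stdGaussian E).real {z | F z ≤ ∫ z', F z' ∂stdGaussian E - t} ≤
      exp (-t ^ 2 / (2 * (π / 2 * K) ^ 2)) := by
  refine le_trans (measureReal_mono fun z (hz : F z ≤ _) ↦ ?_)
    ((hasSubgaussianMGF_stdGaussian_of_lipschitzWith hF).neg.measure_ge_le ht)
  simp only [Set.mem_ofPred_eq, Pi.neg_apply]
  linarith

/-- The standard deviation of `F` is at most `π / 2`, so a large second moment forces a large
mean, and concentration around the mean applies. -/
lemma measureReal_stdGaussian_le_half_le (hF : LipschitzWith 1 F) (hF0 : 0 ≤ F) {r : ℝ}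
    (hr : 5 ≤ r) (h2 : r ^ 2 - 1 ≤ ∫ z, F z ^ 2 ∂stdGaussian E) :
    (stdGaussian E).real {z | F z ≤ r / 2} ≤ exp (-(0.032 * r ^ 2)) := by
  have hpi : π ^ 2 ≤ 10 := by nlinarith [pi_lt_d2, pi_pos]
  have hmean : 0.9 * r ≤ ∫ z, F z ∂stdGaussian E := by
    have hvar := variance_stdGaussian_le_of_lipschitzWith hF
    rw [variance_eq_sub (memLp_stdGaussian_of_lipschitzWith hF 2)] at hvar
    simp only [Pi.pow_apply, NNReal.coe_one, mul_one] at hvar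
    refine le_of_sq_le_sq ?_ (integral_nonneg hF0)
    nlinarith
  calc (stdGaussian E).real {z | F z ≤ r / 2}
      ≤ (stdGaussian E).real {z | F z ≤ ∫ z', F z' ∂stdGaussian E - 0.4 * r} :=
        measureReal_mono fun z (hz : F z ≤ r / 2) ↦
          show F z ≤ ∫ z', F z' ∂stdGaussian E - 0.4 * r by linarith
    _ ≤ exp (-(0.4 * r) ^ 2 / (2 * (π / 2 * (1 : ℝ≥0)) ^ 2)) :=
        measureReal_stdGaussian_le_sub_le hF (by positivity)
    _ ≤ exp (-(0.032 * r ^ 2)) := by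
        refine exp_le_exp.2 ?_
        rw [div_le_iff₀ (by positivity)]
        push_cast
        nlinarith [mul_le_mul_of_nonneg_left hpi (sq_nonneg r)]

end Concentration

section FirmlyNonexpansive

variable {E : Type*} [NormedAddCommGroup E] [InnerProductSpace ℝ E] {T : E → E}

/-- Firmly nonexpansive self-maps of an inner product space; they include all penalized least
squares estimators. -/
def IsFirmlyNonexpansive (T : E → E) : Prop :=
  ∀ x y, ‖T x - T y‖ ^ 2 ≤ ⟪T x - T y, x - y⟫

namespace IsFirmlyNonexpansive

lemma lipschitzWith (hT : IsFirmlyNonexpansive T) : LipschitzWith 1 T := by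
  refine LipschitzWith.mk_one fun x y ↦ ?_
  rw [dist_eq_norm, dist_eq_norm]
  by_contra! hlt
  nlinarith [(hT x y).trans (real_inner_le_norm _ _), norm_nonneg (x - y)]

lemma norm_sub_sub_sub_le (hT : IsFirmlyNonexpansive T) (x y : E) :
    ‖(T x - T y) - (x - y)‖ ≤ ‖x - y‖ := by
  refine le_of_sq_le_sq ?_ (norm_nonneg _)
  rw [norm_sub_sq_real]
  linarith [hT x y, sq_nonneg ‖T x - T y‖]

lemma norm_add_sub_le (hT : IsFirmlyNonexpansive T) (θ w z : E) :
    ‖T (w + z) - w‖ ≤ ‖T (θ + z) - θ‖ + ‖w - θ‖ := by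
  have hres := hT.norm_sub_sub_sub_le (w + z) (θ + z)
  rw [add_sub_add_right_eq_sub] at hres
  calc ‖T (w + z) - w‖ = ‖(T (θ + z) - θ) + ((T (w + z) - T (θ + z)) - (w - θ))‖ := by
        congr 1; abel
    _ ≤ ‖T (θ + z) - θ‖ + ‖w - θ‖ := (norm_add_le _ _).trans (by gcongr)

variable [MeasurableSpace E] [BorelSpace E] [FiniteDimensional ℝ E]

lemma memLp_comp_const_add (hT : IsFirmlyNonexpansive T) (θ : E) :
    MemLp (fun z ↦ T (θ + z)) 2 (stdGaussian E) :=
  memLp_stdGaussian_of_lipschitzWith (hT.lipschitzWith.comp (isometry_add_left θ).lipschitz) 2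

lemma integrable_norm_sub_sq (hT : IsFirmlyNonexpansive T) (θ a : E) :
    Integrable (fun z ↦ ‖T (θ + z) - a‖ ^ 2) (stdGaussian E) :=
  ((hT.memLp_comp_const_add θ).sub (memLp_const a)).norm.integrable_sq

lemma integral_norm_sub_sq_le (hT : IsFirmlyNonexpansive T) (θ w : E) :
    ∫ z, ‖T (w + z) - w‖ ^ 2 ∂stdGaussian E ≤
      2 * ∫ z, ‖T (θ + z) - θ‖ ^ 2 ∂stdGaussian E + 2 * ‖w - θ‖ ^ 2 := by
  have hint := (hT.integrable_norm_sub_sq θ θ).const_mul 2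
  have hpt (z : E) : ‖T (w + z) - w‖ ^ 2 ≤ 2 * ‖T (θ + z) - θ‖ ^ 2 + 2 * ‖w - θ‖ ^ 2 := by
    rw [← mul_add]
    exact (pow_le_pow_left₀ (norm_nonneg _) (hT.norm_add_sub_le θ w z) 2).trans add_sq_le
  calc ∫ z, ‖T (w + z) - w‖ ^ 2 ∂stdGaussian E
      ≤ ∫ z, (2 * ‖T (θ + z) - θ‖ ^ 2 + 2 * ‖w - θ‖ ^ 2) ∂stdGaussian E :=
        integral_mono (hT.integrable_norm_sub_sq w w) (hint.add (integrable_const _)) hpt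
    _ = _ := by
        rw [integral_add hint (integrable_const _), integral_const_mul, integral_const,
          probReal_univ, one_smul]

end IsFirmlyNonexpansive

end FirmlyNonexpansive

section Risk

variable {n : ℕ}

lemma law_eq_map (θ : EuclideanSpace ℝ (Fin n)) :
    law θ = (stdGaussian (EuclideanSpace ℝ (Fin n))).map (fun z ↦ θ + z) := by
  simp [law, multivariateGaussian]

lemma risk_eq_lintegral {δ : EuclideanSpace ℝ (Fin n) → EuclideanSpace ℝ (Fin n)}
    (hδ : Measurable δ) (θ : EuclideanSpace ℝ (Fin n)) :
    risk δ θ = ∫⁻ z, ENNReal.ofReal (‖δ (θ + z) - θ‖ ^ 2)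
      ∂stdGaussian (EuclideanSpace ℝ (Fin n)) := by
  rw [risk, law_eq_map, lintegral_map (by fun_prop) (by fun_prop)]
  simp_rw [← ofReal_norm, ENNReal.ofReal_pow (norm_nonneg _)]

namespace IsFirmlyNonexpansive

variable {T : EuclideanSpace ℝ (Fin n) → EuclideanSpace ℝ (Fin n)}

lemma risk_eq_ofReal_integral (hT : IsFirmlyNonexpansive T) (θ : EuclideanSpace ℝ (Fin n)) :
    risk T θ = ENNReal.ofReal
      (∫ z, ‖T (θ + z) - θ‖ ^ 2 ∂stdGaussian (EuclideanSpace ℝ (Fin n))) := by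
  rw [risk_eq_lintegral hT.lipschitzWith.continuous.measurable,
    ofReal_integral_eq_lintegral_ofReal (hT.integrable_norm_sub_sq θ θ)
      (.of_forall fun z ↦ by positivity)]

lemma risk_ne_top (hT : IsFirmlyNonexpansive T) (θ : EuclideanSpace ℝ (Fin n)) : risk T θ ≠ ∞ := by
  rw [hT.risk_eq_ofReal_integral]; exact ENNReal.ofReal_ne_top

lemma risk_le_ofReal (hT : IsFirmlyNonexpansive T) (θ w : EuclideanSpace ℝ (Fin n)) :
    risk T w ≤ ENNReal.ofReal
      (2 * ∫ z, ‖T (θ + z) - θ‖ ^ 2 ∂stdGaussian (EuclideanSpace ℝ (Fin n)) +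
        2 * ‖w - θ‖ ^ 2) := by
  rw [hT.risk_eq_ofReal_integral]
  exact ENNReal.ofReal_le_ofReal (hT.integral_norm_sub_sq_le θ w)

end IsFirmlyNonexpansive

end Risk

section PenalizedLeastSquares

variable {n : ℕ} {Θ : Set (EuclideanSpace ℝ (Fin n))} {f : EuclideanSpace ℝ (Fin n) → ℝ}

lemma IsPenalizedMin.inner_le (hf : ConvexOn ℝ Θ f) {x a α : EuclideanSpace ℝ (Fin n)}
    (ha : IsPenalizedMin Θ f x a) (hα : α ∈ Θ) : ⟪x - a, α - a⟫ ≤ f α - f a := by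
  have hsegment : ∀ t ∈ Set.Ioo (0 : ℝ) 1,
      ⟪x - a, α - a⟫ - t / 2 * ‖α - a‖ ^ 2 ≤ f α - f a := by
    rintro t ⟨ht0, ht1⟩
    have hmin : 1 / 2 * ‖x - a‖ ^ 2 + f a ≤
        1 / 2 * ‖x - ((1 - t) • a + t • α)‖ ^ 2 + f ((1 - t) • a + t • α) :=
      ha.2 (hf.1 ha.1 hα (by linarith) ht0.le (by ring))
    have hconv : f ((1 - t) • a + t • α) ≤ (1 - t) * f a + t * f α :=
      hf.2 ha.1 hα (by linarith) ht0.le (by ring)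
    have hexp : ‖x - ((1 - t) • a + t • α)‖ ^ 2 =
        ‖x - a‖ ^ 2 - 2 * (t * ⟪x - a, α - a⟫) + t ^ 2 * ‖α - a‖ ^ 2 := by
      rw [show x - ((1 - t) • a + t • α) = (x - a) - t • (α - a) by module, norm_sub_sq_real,
        inner_smul_right, norm_smul, mul_pow, Real.norm_eq_abs, sq_abs]
    refine le_of_mul_le_mul_left ?_ ht0
    linear_combination hmin + hconv + hexp / 2
  have hlim : Filter.Tendsto (fun t : ℝ ↦ ⟪x - a, α - a⟫ - t / 2 * ‖α - a‖ ^ 2)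
      (nhdsWithin 0 (Set.Ioi 0)) (nhds ⟪x - a, α - a⟫) :=
    ((by fun_prop : Continuous _).tendsto' 0 _ (by simp)).mono_left nhdsWithin_le_nhds
  exact le_of_tendsto hlim
    (Filter.eventually_of_mem (Ioo_mem_nhdsGT one_pos) hsegment)

lemma isPenalizedMin_penalizedLSE (hf : f ∈ penalties Θ) (x : EuclideanSpace ℝ (Fin n)) :
    IsPenalizedMin Θ f x (penalizedLSE Θ f x) := by
  rw [penalizedLSE, dif_pos (hf.2.2 x)]
  exact (hf.2.2 x).choose_spec

lemma penalizedLSE_mem (hf : f ∈ penalties Θ) (x : EuclideanSpace ℝ (Fin n)) :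
    penalizedLSE Θ f x ∈ Θ := (isPenalizedMin_penalizedLSE hf x).1

lemma isFirmlyNonexpansive_penalizedLSE (hf : f ∈ penalties Θ) :
    IsFirmlyNonexpansive (penalizedLSE Θ f) := by
  intro x y
  have hx := (isPenalizedMin_penalizedLSE hf x).inner_le hf.1 (penalizedLSE_mem hf y)
  have hy := (isPenalizedMin_penalizedLSE hf y).inner_le hf.1 (penalizedLSE_mem hf x)
  generalize penalizedLSE Θ f x = a at *
  generalize penalizedLSE Θ f y = b at *
  have hsum : ⟪x - a, b - a⟫ + ⟪y - b, a - b⟫ = ‖a - b‖ ^ 2 - ⟪a - b, x - y⟫ := by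
    rw [← neg_sub a b, inner_neg_right, real_inner_comm (a - b), real_inner_comm (a - b),
      ← real_inner_self_eq_norm_sq, ← sub_eq_zero]
    simp only [inner_sub_right]
    ring
  linarith

end PenalizedLeastSquares

section Bias

lemma integral_norm_sub_sq_eq {Ω V : Type*} {mΩ : MeasurableSpace Ω} {μ : Measure Ω}
    [IsProbabilityMeasure μ] [NormedAddCommGroup V] [InnerProductSpace ℝ V] [CompleteSpace V]
    {X : Ω → V} (hX : MemLp X 2 μ) (a : V) :
    ∫ ω, ‖X ω - a‖ ^ 2 ∂μ = ∫ ω, ‖X ω - ∫ ω', X ω' ∂μ‖ ^ 2 ∂μ + ‖∫ ω, X ω ∂μ - a‖ ^ 2 := by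
  set m := ∫ ω, X ω ∂μ
  have hcenter : Integrable (fun ω ↦ X ω - m) μ :=
    (hX.integrable one_le_two).sub (integrable_const m)
  have hsq : Integrable (fun ω ↦ ‖X ω - m‖ ^ 2) μ := (hX.sub (memLp_const m)).norm.integrable_sq
  have hinner : Integrable (fun ω ↦ 2 * ⟪m - a, X ω - m⟫) μ :=
    (hcenter.const_inner _).const_mul 2
  have hexpand (ω : Ω) :
      ‖X ω - a‖ ^ 2 = ‖X ω - m‖ ^ 2 + 2 * ⟪m - a, X ω - m⟫ + ‖m - a‖ ^ 2 := by
    rw [← sub_add_sub_cancel (X ω) m a, norm_add_sq_real, real_inner_comm]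
  simp_rw [hexpand]
  rw [integral_add (hsq.fun_add hinner) (integrable_const _), integral_add hsq hinner,
    integral_const_mul, integral_inner hcenter, integral_sub (hX.integrable one_le_two)
    (integrable_const m)]
  simp [m]

/-- The expectation of `g` under the Gaussian law with mean `θ` and identity covariance, as a
function of `θ`. -/
noncomputable def gaussianMean {E V : Type*} [NormedAddCommGroup E] [InnerProductSpace ℝ E]
    [FiniteDimensional ℝ E] [MeasurableSpace E] [NormedAddCommGroup V] [NormedSpace ℝ V]
    (g : E → V) (θ : E) : V :=
  ∫ z, g (θ + z) ∂stdGaussian E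

namespace IsFirmlyNonexpansive

variable {E : Type*} [NormedAddCommGroup E] [InnerProductSpace ℝ E] [FiniteDimensional ℝ E]
  [MeasurableSpace E] [BorelSpace E] {T : E → E}

lemma integral_norm_sub_sq_sub_le (hT : IsFirmlyNonexpansive T) (θ w : E) :
    ∫ z, ‖T (θ + z) - θ‖ ^ 2 ∂stdGaussian E - ‖gaussianMean T θ - θ‖ ^ 2 ≤
      ∫ z, ‖T (θ + z) - w‖ ^ 2 ∂stdGaussian E := by
  rw [integral_norm_sub_sq_eq (hT.memLp_comp_const_add θ) θ,
    integral_norm_sub_sq_eq (hT.memLp_comp_const_add θ) w, gaussianMean, add_sub_cancel_right]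
  exact le_add_of_nonneg_right (sq_nonneg _)

lemma integrable_comp_const_add (hT : IsFirmlyNonexpansive T) (θ : E) :
    Integrable (fun z ↦ T (θ + z)) (stdGaussian E) :=
  (hT.memLp_comp_const_add θ).integrable one_le_two

lemma integrable_sub (hT : IsFirmlyNonexpansive T) (θ : E) :
    Integrable (fun z ↦ θ + z - T (θ + z)) (stdGaussian E) :=
  ((integrable_const θ).add IsGaussian.integrable_id).sub (hT.integrable_comp_const_add θ)

lemma integral_sub_eq (hT : IsFirmlyNonexpansive T) (θ : E) :
    ∫ z, (θ + z - T (θ + z)) ∂stdGaussian E = θ - gaussianMean T θ := by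
  have hid : Integrable (fun z : E ↦ z) (stdGaussian E) := IsGaussian.integrable_id
  rw [integral_sub ((integrable_const θ).fun_add hid) (hT.integrable_comp_const_add θ),
    integral_add (integrable_const θ) hid, integral_id_stdGaussian, integral_const, probReal_univ,
    one_smul, add_zero, gaussianMean]

end IsFirmlyNonexpansive

variable {n : ℕ} {Θ : Set (EuclideanSpace ℝ (Fin n))} {f : EuclideanSpace ℝ (Fin n) → ℝ}

/-- The optimal value of the penalized least squares problem, that is, the Moreau envelope of the
penalty restricted to `Θ`. -/
noncomputable def envelope (Θ : Set (EuclideanSpace ℝ (Fin n))) (f : EuclideanSpace ℝ (Fin n) → ℝ)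
    (x : EuclideanSpace ℝ (Fin n)) : ℝ :=
  1 / 2 * ‖x - penalizedLSE Θ f x‖ ^ 2 + f (penalizedLSE Θ f x)

lemma envelope_le (hf : f ∈ penalties Θ) (x : EuclideanSpace ℝ (Fin n))
    {α : EuclideanSpace ℝ (Fin n)} (hα : α ∈ Θ) : envelope Θ f x ≤ 1 / 2 * ‖x - α‖ ^ 2 + f α :=
  (isPenalizedMin_penalizedLSE hf x).2 hα

lemma le_envelope (hf : f ∈ penalties Θ) {B : ℝ} (hB : B ∈ lowerBounds (f '' Θ))
    (x : EuclideanSpace ℝ (Fin n)) : B ≤ envelope Θ f x :=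
  (hB ⟨_, penalizedLSE_mem hf x, rfl⟩).trans (le_add_of_nonneg_left (by positivity))

lemma envelope_add_le (hf : f ∈ penalties Θ) (x h : EuclideanSpace ℝ (Fin n)) :
    envelope Θ f (x + h) ≤
      envelope Θ f x + (⟪h, x - penalizedLSE Θ f x⟫ + 1 / 2 * ‖h‖ ^ 2) := by
  refine (envelope_le hf (x + h) (penalizedLSE_mem hf x)).trans_eq ?_
  rw [add_sub_right_comm, norm_add_sq_real, real_inner_comm, envelope]
  ring

lemma continuous_envelope (hf : f ∈ penalties Θ) : Continuous (envelope Θ f) := by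
  have hp := (isFirmlyNonexpansive_penalizedLSE hf).lipschitzWith.continuous
  refine continuous_iff_continuousAt.2 fun x ↦ ?_
  have hlower : Continuous fun y ↦
      envelope Θ f x - (⟪x - y, y - penalizedLSE Θ f y⟫ + 1 / 2 * ‖x - y‖ ^ 2) := by fun_prop
  have hupper : Continuous fun y ↦
      envelope Θ f x + (⟪y - x, x - penalizedLSE Θ f x⟫ + 1 / 2 * ‖y - x‖ ^ 2) := by fun_prop
  refine tendsto_of_tendsto_of_tendsto_of_le_of_le (hlower.tendsto' x _ (by simp))
    (hupper.tendsto' x _ (by simp)) (fun y ↦ ?_) fun y ↦ ?_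
  · simpa only [add_sub_cancel, sub_le_iff_le_add] using envelope_add_le hf y (x - y)
  · simpa only [add_sub_cancel] using envelope_add_le hf x (y - x)

lemma integrable_envelope (hΘ : Θ.Nonempty) (hf : f ∈ penalties Θ)
    (θ : EuclideanSpace ℝ (Fin n)) :
    Integrable (fun z ↦ envelope Θ f (θ + z)) (stdGaussian (EuclideanSpace ℝ (Fin n))) := by
  obtain ⟨α, hα⟩ := hΘ
  obtain ⟨B, hB⟩ := hf.2.1
  have hsq : Integrable (fun z ↦ ‖θ + z - α‖ ^ 2) (stdGaussian (EuclideanSpace ℝ (Fin n))) :=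
    (((memLp_const θ).add IsGaussian.memLp_two_id).sub (memLp_const α)).norm.integrable_sq
  exact integrable_of_le_of_le
    ((continuous_envelope hf).comp (continuous_const_add θ)).aestronglyMeasurable
    (.of_forall fun z ↦ le_envelope hf hB (θ + z)) (.of_forall fun z ↦ envelope_le hf (θ + z) hα)
    (integrable_const B) ((hsq.const_mul (1 / 2)).add (integrable_const (f α)))

lemma gaussianMean_penalizedLSE_mem (hΘ : Θ ∈ parameterSets n) (hf : f ∈ penalties Θ)
    (θ : EuclideanSpace ℝ (Fin n)) : gaussianMean (penalizedLSE Θ f) θ ∈ Θ :=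
  hΘ.2.1.integral_mem hΘ.1 (.of_forall fun _ ↦ penalizedLSE_mem hf _)
    ((isFirmlyNonexpansive_penalizedLSE hf).integrable_comp_const_add θ)

/-- The residual `x - penalizedLSE Θ f x` is the gradient of the envelope, so moving `θ` to the mean
of the estimator is a unit gradient step for the smoothed envelope. -/
lemma gaussianMean_envelope_gaussianMean_le (hΘ : Θ.Nonempty) (hf : f ∈ penalties Θ)
    (θ : EuclideanSpace ℝ (Fin n)) :
    gaussianMean (envelope Θ f) (gaussianMean (penalizedLSE Θ f) θ) ≤
      gaussianMean (envelope Θ f) θ - 1 / 2 * ‖gaussianMean (penalizedLSE Θ f) θ - θ‖ ^ 2 := by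
  have hp := isFirmlyNonexpansive_penalizedLSE hf
  set p := penalizedLSE Θ f
  set h := gaussianMean p θ - θ with hh
  have hm : gaussianMean p θ = θ + h := by rw [hh, add_sub_cancel]
  have hinner : Integrable (fun z ↦ ⟪h, θ + z - p (θ + z)⟫)
      (stdGaussian (EuclideanSpace ℝ (Fin n))) := (hp.integrable_sub θ).const_inner h
  have hresidual : ∫ z, ⟪h, θ + z - p (θ + z)⟫ ∂stdGaussian (EuclideanSpace ℝ (Fin n)) =
      -‖h‖ ^ 2 := by
    rw [integral_inner (hp.integrable_sub θ), hp.integral_sub_eq, ← neg_sub, inner_neg_right,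
      real_inner_self_eq_norm_sq]
  have henv := integrable_envelope hΘ hf θ
  rw [hm]
  calc gaussianMean (envelope Θ f) (θ + h)
      ≤ ∫ z, (envelope Θ f (θ + z) + (⟪h, θ + z - p (θ + z)⟫ + 1 / 2 * ‖h‖ ^ 2))
          ∂stdGaussian (EuclideanSpace ℝ (Fin n)) := by
        refine integral_mono (integrable_envelope hΘ hf _)
          (henv.add (hinner.add (integrable_const _))) fun z ↦ ?_
        simpa only [add_right_comm] using envelope_add_le hf (θ + z) h
    _ = gaussianMean (envelope Θ f) θ - 1 / 2 * ‖h‖ ^ 2 := by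
        rw [integral_add henv (hinner.fun_add (integrable_const _)),
          integral_add hinner (integrable_const _), hresidual, integral_const, probReal_univ,
          one_smul, gaussianMean]
        ring

lemma exists_norm_gaussianMean_sub_le (hΘ : Θ ∈ parameterSets n) (hf : f ∈ penalties Θ) {ε : ℝ}
    (hε : 0 < ε) : ∃ θ ∈ Θ, ‖gaussianMean (penalizedLSE Θ f) θ - θ‖ ≤ ε := by
  obtain ⟨B, hB⟩ := hf.2.1
  have hbdd : BddBelow (gaussianMean (envelope Θ f) '' Θ) := by
    refine ⟨B, Set.forall_mem_image.2 fun θ _ ↦ ?_⟩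
    simpa [gaussianMean] using integral_mono (μ := stdGaussian (EuclideanSpace ℝ (Fin n)))
      (integrable_const B) (integrable_envelope hΘ.2.2 hf θ) fun z ↦ le_envelope hf hB (θ + z)
  obtain ⟨_, ⟨θ, hθ, rfl⟩, hlt⟩ := exists_lt_of_csInf_lt (hΘ.2.2.image _)
    (lt_add_of_pos_right (sInf (gaussianMean (envelope Θ f) '' Θ)) (half_pos (sq_pos_of_pos hε)))
  refine ⟨θ, hθ, le_of_sq_le_sq ?_ hε.le⟩
  have hstep := gaussianMean_envelope_gaussianMean_le hΘ.2.2 hf θ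
  have hinf := csInf_le hbdd (Set.mem_image_of_mem _ (gaussianMean_penalizedLSE_mem hΘ hf θ))
  linarith

end Bias

section Testing

lemma ofReal_one_sub_le_measure_le_of_lintegral_sq_le {Ω : Type*} {mΩ : MeasurableSpace Ω}
    {μ : Measure Ω} [IsProbabilityMeasure μ] {g : Ω → ℝ} (hg : Measurable g) {c s : ℝ}
    (hc : 0 ≤ c) (hs : 0 < s) (h : ∫⁻ ω, ENNReal.ofReal (g ω ^ 2) ∂μ ≤ ENNReal.ofReal (c * s ^ 2)) :
    ENNReal.ofReal (1 - c) ≤ μ {ω | g ω ≤ s} := by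
  have htail : μ {ω | g ω ≤ s}ᶜ ≤ ENNReal.ofReal c := calc
    μ {ω | g ω ≤ s}ᶜ ≤ μ {ω | ENNReal.ofReal (s ^ 2) ≤ ENNReal.ofReal (g ω ^ 2)} :=
      measure_mono fun ω (hω : ¬ g ω ≤ s) ↦
        ENNReal.ofReal_le_ofReal (pow_le_pow_left₀ hs.le (not_le.1 hω).le 2)
    _ ≤ (∫⁻ ω, ENNReal.ofReal (g ω ^ 2) ∂μ) / ENNReal.ofReal (s ^ 2) :=
      meas_ge_le_lintegral_div (by fun_prop) (by simpa using hs.ne') ENNReal.ofReal_ne_top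
    _ ≤ ENNReal.ofReal (c * s ^ 2) / ENNReal.ofReal (s ^ 2) := by gcongr
    _ = ENNReal.ofReal c := by
      rw [← ENNReal.ofReal_div_of_pos (by positivity), mul_div_cancel_right₀ _ (by positivity)]
  rw [ENNReal.ofReal_sub _ hc, ENNReal.ofReal_one, tsub_le_iff_right,
    ← prob_add_prob_compl (μ := μ) (measurableSet_le hg measurable_const)]
  gcongr

lemma mul_measure_le_mul_of_forall_le_measure_section {α β : Type*} [MeasurableSpace α]
    [MeasurableSpace β] {μ : Measure α} {ν : Measure β} [SFinite μ] [SFinite ν]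
    {S : Set (α × β)} (hS : MeasurableSet S) {G : Set α} (hG : MeasurableSet G) {p q : ℝ≥0∞}
    (hp : ∀ x ∈ G, p ≤ ν {y | (x, y) ∈ S}) (hq : ∀ y, μ {x | (x, y) ∈ S} ≤ q) :
    p * μ G ≤ q * ν Set.univ :=
  calc p * μ G = ∫⁻ _ in G, p ∂μ := (setLIntegral_const G p).symm
    _ ≤ ∫⁻ x in G, ν {y | (x, y) ∈ S} ∂μ := setLIntegral_mono' hG hp
    _ ≤ ∫⁻ x, ν {y | (x, y) ∈ S} ∂μ := setLIntegral_le_lintegral _ _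
    _ = (μ.prod ν) S := (Measure.prod_apply hS).symm
    _ = ∫⁻ y, μ {x | (x, y) ∈ S} ∂ν := Measure.prod_apply_symm hS
    _ ≤ ∫⁻ _, q ∂ν := lintegral_mono hq
    _ = q * ν Set.univ := lintegral_const q

lemma sq_measure_preimage_add_le {E : Type*} [NormedAddCommGroup E] [InnerProductSpace ℝ E]
    [FiniteDimensional ℝ E] [MeasurableSpace E] [BorelSpace E] (h : E) {S : Set E}
    (hS : MeasurableSet S) :
    stdGaussian E ((h + ·) ⁻¹' S) ^ 2 ≤ ENNReal.ofReal (exp (‖h‖ ^ 2)) * stdGaussian E S := by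
  have hshift : stdGaussian E ((h + ·) ⁻¹' S) =
      ∫⁻ z, ENNReal.ofReal (likelihood h z) * S.indicator 1 z ∂stdGaussian E := by
    rw [← lintegral_stdGaussian_add h (measurable_one.indicator hS),
      ← lintegral_indicator_one (measurable_const_add h hS)]
    rfl
  have hholder := ENNReal.lintegral_mul_le_Lp_mul_Lq (stdGaussian E) .two_two
    (f := fun z ↦ ENNReal.ofReal (likelihood h z)) (g := S.indicator 1) (by fun_prop)
    (measurable_one.indicator hS).aemeasurable
  have hind (z : E) : (S.indicator 1 z : ℝ≥0∞) ^ (2 : ℝ) = S.indicator 1 z := by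
    by_cases hz : z ∈ S <;> simp [hz]
  have hlik (z : E) : ENNReal.ofReal (likelihood h z) ^ (2 : ℝ) =
      ENNReal.ofReal (likelihood h z ^ 2) := by
    rw [ENNReal.rpow_two, ENNReal.ofReal_pow (likelihood_nonneg h z)]
  simp_rw [hind, hlik] at hholder
  rw [lintegral_likelihood_sq, lintegral_indicator_one hS,
    ← ENNReal.mul_rpow_of_nonneg _ _ (by norm_num), one_div] at hholder
  rw [hshift, ← ENNReal.rpow_two]
  exact (ENNReal.le_rpow_inv_iff two_pos).1 hholder

lemma sub_mul_sq_le_sq_add_mul_sq {a b d L : ℝ} (hd : 0 ≤ d) (hL : 0 ≤ L) (h : d ≤ a + b) :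
    (7 * L - L ^ 2) / 16 * d ^ 2 ≤ a ^ 2 + L * b ^ 2 := by
  have hdab : d ^ 2 ≤ (a + b) ^ 2 := by gcongr
  have hmin : L * d ^ 2 ≤ (1 + L) * (a ^ 2 + L * b ^ 2) := by
    linarith [sq_nonneg (a - L * b), mul_le_mul_of_nonneg_left hdab hL]
  have htangent : 0 ≤ L * d ^ 2 * (L - 3) ^ 2 / 16 := by positivity
  refine le_of_mul_le_mul_left (le_trans ?_ hmin) (by positivity : 0 < 1 + L)
  linear_combination htangent

variable {n : ℕ} {δ : EuclideanSpace ℝ (Fin n) → EuclideanSpace ℝ (Fin n)}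

lemma risk_eq_lintegral_likelihood (hδ : Measurable δ) (θ₀ θ₁ : EuclideanSpace ℝ (Fin n)) :
    risk δ θ₁ = ∫⁻ z, ENNReal.ofReal (likelihood (θ₁ - θ₀) z * ‖δ (θ₀ + z) - θ₁‖ ^ 2)
      ∂stdGaussian (EuclideanSpace ℝ (Fin n)) := by
  have hshift := lintegral_stdGaussian_add (θ₁ - θ₀)
    (g := fun y ↦ ENNReal.ofReal (‖δ (θ₀ + y) - θ₁‖ ^ 2)) (by fun_prop)
  simp_rw [← add_assoc, add_sub_cancel] at hshift
  simp_rw [risk_eq_lintegral hδ, hshift, ENNReal.ofReal_mul (likelihood_nonneg _ _)]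

lemma ofReal_le_risk_add_risk (hδ : Measurable δ) {θ₀ θ₁ : EuclideanSpace ℝ (Fin n)}
    (h : ‖θ₁ - θ₀‖ ≤ 1) :
    ENNReal.ofReal (‖θ₁ - θ₀‖ ^ 2 / 4) ≤ risk δ θ₀ + risk δ θ₁ := by
  set L := likelihood (θ₁ - θ₀)
  set d := ‖θ₁ - θ₀‖
  have hexp : exp (d ^ 2) ≤ 3 :=
    (exp_le_exp.2 (pow_le_one₀ (norm_nonneg _) h)).trans exp_one_lt_three.le
  have hpt (z : EuclideanSpace ℝ (Fin n)) :
      ENNReal.ofReal (7 / 16 * d ^ 2) * ENNReal.ofReal (L z) ≤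
        ENNReal.ofReal (‖δ (θ₀ + z) - θ₀‖ ^ 2) +
          ENNReal.ofReal (L z * ‖δ (θ₀ + z) - θ₁‖ ^ 2) +
        ENNReal.ofReal (d ^ 2 / 16) * ENNReal.ofReal (L z ^ 2) := by
    have hL : 0 ≤ L z := likelihood_nonneg _ z
    have htri : d ≤ ‖δ (θ₀ + z) - θ₀‖ + ‖δ (θ₀ + z) - θ₁‖ := by
      rw [add_comm, norm_sub_rev _ θ₁]
      exact norm_sub_le_norm_sub_add_norm_sub _ _ _
    have hreal := sub_mul_sq_le_sq_add_mul_sq (norm_nonneg _) hL htri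
    rw [← ENNReal.ofReal_mul (by positivity), ← ENNReal.ofReal_mul (by positivity),
      ← ENNReal.ofReal_add (by positivity) (by positivity),
      ← ENNReal.ofReal_add (by positivity) (by positivity)]
    exact ENNReal.ofReal_le_ofReal (by linarith)
  have hint := lintegral_mono (μ := stdGaussian (EuclideanSpace ℝ (Fin n))) hpt
  rw [lintegral_const_mul _ (by fun_prop), lintegral_likelihood, mul_one,
    lintegral_add_right _ (by fun_prop), lintegral_const_mul _ (by fun_prop),
    lintegral_add_left (by fun_prop), ← risk_eq_lintegral hδ, ← risk_eq_lintegral_likelihood hδ,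
    lintegral_likelihood_sq, ← ENNReal.ofReal_mul (by positivity)] at hint
  refine le_trans ?_ (tsub_le_iff_right.2 hint)
  rw [← ENNReal.ofReal_sub _ (by positivity)]
  exact ENNReal.ofReal_le_ofReal (by nlinarith [mul_le_mul_of_nonneg_left hexp (sq_nonneg d)])

lemma ofReal_exp_le_measure_norm_sub_le (hδ : Measurable δ) {w : EuclideanSpace ℝ (Fin n)}
    {s : ℝ} (hs : 0 < s) (hw : risk δ w ≤ ENNReal.ofReal (1 / 4 * s ^ 2))
    (θ : EuclideanSpace ℝ (Fin n)) :
    ENNReal.ofReal (9 / 16 * exp (-‖w - θ‖ ^ 2)) ≤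
      stdGaussian (EuclideanSpace ℝ (Fin n)) {z | ‖δ (θ + z) - w‖ ≤ s} := by
  rw [risk_eq_lintegral hδ] at hw
  have hclose := ofReal_one_sub_le_measure_le_of_lintegral_sq_le (by fun_prop) (by norm_num) hs hw
  have hchange := sq_measure_preimage_add_le (w - θ)
    (S := {z | ‖δ (θ + z) - w‖ ≤ s}) (measurableSet_le (by fun_prop) measurable_const)
  have hset : ((w - θ) + ·) ⁻¹' {z | ‖δ (θ + z) - w‖ ≤ s} = {z | ‖δ (w + z) - w‖ ≤ s} := by
    ext z; simp [← add_assoc]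
  rw [hset] at hchange
  have h916 : ENNReal.ofReal (9 / 16) ≤ ENNReal.ofReal (exp (‖w - θ‖ ^ 2)) *
      stdGaussian (EuclideanSpace ℝ (Fin n)) {z | ‖δ (θ + z) - w‖ ≤ s} := by
    refine le_trans ?_ ((pow_le_pow_left₀ zero_le hclose 2).trans hchange)
    rw [← ENNReal.ofReal_pow (by norm_num)]
    norm_num
  rw [exp_neg, ← div_eq_mul_inv, ENNReal.ofReal_div_of_pos (exp_pos _)]
  exact ENNReal.div_le_of_le_mul' h916

end Testing

section LowerBound

lemma exists_mem_norm_sub_eq {E : Type*} [NormedAddCommGroup E] [NormedSpace ℝ E] {C : Set E}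
    (hC : Convex ℝ C) {x y : E} (hx : x ∈ C) (hy : y ∈ C) {d : ℝ} (hd : 0 ≤ d)
    (hdxy : d ≤ ‖y - x‖) : ∃ w ∈ C, ‖w - x‖ = d := by
  rcases eq_or_lt_of_le (norm_nonneg (y - x)) with h0 | hpos
  · exact ⟨x, hx, by rw [sub_self, norm_zero]; linarith⟩
  · refine ⟨x + (d / ‖y - x‖) • (y - x), hC.add_smul_sub_mem hx hy
      ⟨by positivity, (div_le_one hpos).2 hdxy⟩, ?_⟩
    rw [add_sub_cancel_left, norm_smul, norm_div, norm_norm, Real.norm_of_nonneg hd,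
      div_mul_cancel₀ _ hpos.ne']

variable {n : ℕ} {Θ : Set (EuclideanSpace ℝ (Fin n))}
  {T δ : EuclideanSpace ℝ (Fin n) → EuclideanSpace ℝ (Fin n)} {θ₀ : EuclideanSpace ℝ (Fin n)}
  {r : ℝ}

lemma exists_mul_risk_lt_of_le (hΘ : Convex ℝ Θ) (hT : IsFirmlyNonexpansive T)
    (hTΘ : ∀ x, T x ∈ Θ) (hδ : Measurable δ) (hθ₀ : θ₀ ∈ Θ) (hr0 : 0 < r) (hr : r ≤ 20)
    (hrisk : ∫ z, ‖T (θ₀ + z) - θ₀‖ ^ 2 ∂stdGaussian (EuclideanSpace ℝ (Fin n)) = r ^ 2) :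
    ∃ θ ∈ Θ, ENNReal.ofReal (1 / 5000) * risk T θ < risk δ θ := by
  by_contra! hall
  set d := min 1 r
  have hd0 : 0 ≤ d := le_min zero_le_one hr0.le
  obtain ⟨z, hz⟩ := exists_integral_le (hT.integrable_norm_sub_sq θ₀ θ₀)
  rw [hrisk] at hz
  obtain ⟨θ₁, hθ₁, hnorm⟩ := exists_mem_norm_sub_eq hΘ hθ₀ (hTΘ (θ₀ + z)) hd0
    ((min_le_right 1 r).trans (le_of_sq_le_sq hz (norm_nonneg _)))
  have htest := ofReal_le_risk_add_risk hδ (hnorm.trans_le (min_le_left 1 r))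
  have hbound : ENNReal.ofReal (d ^ 2 / 4) ≤
      ENNReal.ofReal (1 / 5000 * r ^ 2 + 1 / 5000 * (2 * r ^ 2 + 2 * d ^ 2)) := by
    rw [ENNReal.ofReal_add (by positivity) (by positivity), ENNReal.ofReal_mul (by positivity),
      ENNReal.ofReal_mul (by positivity), ← hrisk, ← hT.risk_eq_ofReal_integral, ← hnorm]
    refine htest.trans (add_le_add (hall θ₀ hθ₀) ((hall θ₁ hθ₁).trans ?_))
    gcongr
    exact hT.risk_le_ofReal θ₀ θ₁
  rw [ENNReal.ofReal_le_ofReal_iff (by positivity)] at hbound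
  rcases min_cases 1 r with ⟨h, -⟩ | ⟨h, -⟩ <;> simp only [d, h] at hbound <;> nlinarith

/-- The estimator `T` pulled towards `θ₀`. Its law at `θ₀` is the prior against which arbitrary
estimators are tested; the factor `1 / 12` keeps the prior close enough to `θ₀` for the cost of a
change of measure to stay below the concentration of `T`. -/
noncomputable def shrunk {E : Type*} [NormedAddCommGroup E] [NormedSpace ℝ E]
    (T : E → E) (θ₀ z : E) : E :=
  θ₀ + (1 / 12 : ℝ) • (T (θ₀ + z) - θ₀)

lemma norm_shrunk_sub {E : Type*} [NormedAddCommGroup E] [NormedSpace ℝ E] (T : E → E) (θ₀ z : E) :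
    ‖shrunk T θ₀ z - θ₀‖ = ‖T (θ₀ + z) - θ₀‖ / 12 := by
  rw [shrunk, add_sub_cancel_left, norm_smul, Real.norm_of_nonneg (by norm_num)]
  ring

lemma shrunk_mem (hΘ : Convex ℝ Θ) (hTΘ : ∀ x, T x ∈ Θ) (hθ₀ : θ₀ ∈ Θ)
    (z : EuclideanSpace ℝ (Fin n)) : shrunk T θ₀ z ∈ Θ :=
  hΘ.add_smul_sub_mem hθ₀ (hTΘ _) ⟨by norm_num, by norm_num⟩

lemma measure_norm_sub_shrunk_le (hT : IsFirmlyNonexpansive T) (hr : 5 ≤ r)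
    (hrisk : ∫ z, ‖T (θ₀ + z) - θ₀‖ ^ 2 ∂stdGaussian (EuclideanSpace ℝ (Fin n)) = r ^ 2)
    (hbias : ‖gaussianMean T θ₀ - θ₀‖ ≤ 1) (a : EuclideanSpace ℝ (Fin n)) :
    stdGaussian (EuclideanSpace ℝ (Fin n)) {z | ‖a - shrunk T θ₀ z‖ ≤ r / 24} ≤
      ENNReal.ofReal (exp (-(0.032 * r ^ 2))) := by
  set b := θ₀ + (12 : ℝ) • (a - θ₀)
  have hF : LipschitzWith 1 (fun z ↦ ‖T (θ₀ + z) - b‖) := by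
    simpa [dist_eq_norm, Function.comp_def] using (LipschitzWith.dist_left b).comp
      (hT.lipschitzWith.comp (isometry_add_left θ₀).lipschitz)
  have hsecond : r ^ 2 - 1 ≤
      ∫ z, ‖T (θ₀ + z) - b‖ ^ 2 ∂stdGaussian (EuclideanSpace ℝ (Fin n)) := by
    have hmean := hT.integral_norm_sub_sq_sub_le θ₀ b
    rw [hrisk] at hmean
    exact le_trans (sub_le_sub_left (pow_le_one₀ (norm_nonneg _) hbias) _) hmean
  have hset : {z | ‖a - shrunk T θ₀ z‖ ≤ r / 24} ⊆ {z | ‖T (θ₀ + z) - b‖ ≤ r / 2} := by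
    intro z (hz : ‖a - shrunk T θ₀ z‖ ≤ r / 24)
    change ‖T (θ₀ + z) - b‖ ≤ r / 2
    have hscale : T (θ₀ + z) - b = -((12 : ℝ) • (a - shrunk T θ₀ z)) := by
      simp only [b, shrunk]; module
    rw [hscale, norm_neg, norm_smul, Real.norm_of_nonneg (by norm_num)]
    linarith
  refine (measure_mono hset).trans ?_
  rw [← ofReal_measureReal]
  exact ENNReal.ofReal_le_ofReal
    (measureReal_stdGaussian_le_half_le hF (fun z ↦ norm_nonneg _) hr hsecond)

lemma le_measure_norm_sub_shrunk (hT : IsFirmlyNonexpansive T) (hδ : Measurable δ) (hr : 0 < r)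
    (hrisk : ∫ z, ‖T (θ₀ + z) - θ₀‖ ^ 2 ∂stdGaussian (EuclideanSpace ℝ (Fin n)) = r ^ 2)
    {y : EuclideanSpace ℝ (Fin n)} (hy : ‖T (θ₀ + y) - θ₀‖ ≤ 2 * r)
    (hrisk_le : risk δ (shrunk T θ₀ y) ≤ ENNReal.ofReal (1 / 5000) * risk T (shrunk T θ₀ y)) :
    ENNReal.ofReal (9 / 16 * exp (-(r ^ 2 / 36))) ≤
      stdGaussian (EuclideanSpace ℝ (Fin n)) {z | ‖δ (θ₀ + z) - shrunk T θ₀ y‖ ≤ r / 24} := by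
  have hdist : ‖shrunk T θ₀ y - θ₀‖ ^ 2 ≤ r ^ 2 / 36 := by
    rw [norm_shrunk_sub]
    nlinarith [norm_nonneg (T (θ₀ + y) - θ₀)]
  have hsmall : risk δ (shrunk T θ₀ y) ≤ ENNReal.ofReal (1 / 4 * (r / 24) ^ 2) := by
    refine hrisk_le.trans ((mul_le_mul_right (hT.risk_le_ofReal θ₀ _) _).trans ?_)
    rw [← ENNReal.ofReal_mul (by norm_num), hrisk]
    exact ENNReal.ofReal_le_ofReal (by nlinarith)
  refine le_trans (ENNReal.ofReal_le_ofReal ?_)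
    (ofReal_exp_le_measure_norm_sub_le hδ (by positivity) hsmall θ₀)
  gcongr

lemma exp_neg_lt_mul_exp_neg (hr : 20 ≤ r) :
    exp (-(0.032 * r ^ 2)) < 9 / 16 * exp (-(r ^ 2 / 36)) * (3 / 4) := by
  set gap := (0.032 - 1 / 36) * r ^ 2
  have hgap : 64 / 27 < exp gap := by
    refine lt_of_lt_of_le ?_ (add_one_le_exp gap)
    simp only [gap]
    nlinarith
  have hsplit : exp (-(r ^ 2 / 36)) = exp gap * exp (-(0.032 * r ^ 2)) := by
    rw [← exp_add]; congr 1; simp only [gap]; ring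
  rw [hsplit]
  nlinarith [mul_lt_mul_of_pos_right hgap (exp_pos (-(0.032 * r ^ 2)))]

lemma exists_mul_risk_lt_of_ge (hΘ : Convex ℝ Θ) (hT : IsFirmlyNonexpansive T)
    (hTΘ : ∀ x, T x ∈ Θ) (hδ : Measurable δ) (hθ₀ : θ₀ ∈ Θ)
    (hbias : ‖gaussianMean T θ₀ - θ₀‖ ≤ 1) (hr : 20 ≤ r)
    (hrisk : ∫ z, ‖T (θ₀ + z) - θ₀‖ ^ 2 ∂stdGaussian (EuclideanSpace ℝ (Fin n)) = r ^ 2) :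
    ∃ θ ∈ Θ, ENNReal.ofReal (1 / 5000) * risk T θ < risk δ θ := by
  by_contra! hall
  have hr0 : 0 < r := by linarith
  have hTm : Measurable T := hT.lipschitzWith.continuous.measurable
  set G := {y | ‖T (θ₀ + y) - θ₀‖ ≤ 2 * r}
  have hGm : MeasurableSet G := measurableSet_le (by fun_prop) measurable_const
  have hG : ENNReal.ofReal (3 / 4) ≤ stdGaussian (EuclideanSpace ℝ (Fin n)) G := by
    have hsecond : ∫⁻ z, ENNReal.ofReal (‖T (θ₀ + z) - θ₀‖ ^ 2)
        ∂stdGaussian (EuclideanSpace ℝ (Fin n)) ≤ ENNReal.ofReal (1 / 4 * (2 * r) ^ 2) := by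
      rw [← risk_eq_lintegral hTm, hT.risk_eq_ofReal_integral, hrisk]
      exact ENNReal.ofReal_le_ofReal (by linarith)
    have hcheb := ofReal_one_sub_le_measure_le_of_lintegral_sq_le
      (by fun_prop) (by norm_num) (by positivity) hsecond
    norm_num at hcheb ⊢
    exact hcheb
  have hcount := mul_measure_le_mul_of_forall_le_measure_section
    (S := {p | ‖δ (θ₀ + p.2) - shrunk T θ₀ p.1‖ ≤ r / 24})
    (measurableSet_le (by unfold shrunk; fun_prop) measurable_const) hGm
    (fun y hy ↦ le_measure_norm_sub_shrunk hT hδ hr0 hrisk hy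
      (hall _ (shrunk_mem hΘ hTΘ hθ₀ y)))
    (fun z ↦ measure_norm_sub_shrunk_le hT (by linarith) hrisk hbias (δ (θ₀ + z)))
  rw [measure_univ, mul_one] at hcount
  have hexp : ENNReal.ofReal (9 / 16 * exp (-(r ^ 2 / 36)) * (3 / 4)) ≤
      ENNReal.ofReal (exp (-(0.032 * r ^ 2))) := by
    rw [ENNReal.ofReal_mul (by positivity)]
    exact (mul_le_mul_right hG _).trans hcount
  rw [ENNReal.ofReal_le_ofReal_iff (by positivity)] at hexp
  exact absurd (exp_neg_lt_mul_exp_neg hr) hexp.not_gt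

lemma le_riskRatio {c a b : ℝ≥0∞} (hc : c ≤ 1) (hb : b ≠ ∞) (h : c * b ≤ a) :
    c ≤ riskRatio a b := by
  rw [riskRatio]
  split_ifs with h0
  · exact hc
  · rcases eq_or_ne b 0 with rfl | hb0
    · rw [ENNReal.div_zero (by tauto)]
      exact le_top
    · exact (ENNReal.le_div_iff_mul_le (.inl hb0) (.inl hb)).2 h

variable {f : EuclideanSpace ℝ (Fin n) → ℝ}

theorem le_normalizedMinimaxRisk (hΘ : Θ ∈ parameterSets n) (hf : f ∈ penalties Θ) :
    ENNReal.ofReal (1 / 5000) ≤ normalizedMinimaxRisk Θ f := by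
  refine le_iInf₂ fun δ hδ ↦ ?_
  have hT := isFirmlyNonexpansive_penalizedLSE hf
  have hTΘ := penalizedLSE_mem hf
  obtain ⟨θ₀, hθ₀, hbias⟩ := exists_norm_gaussianMean_sub_le hΘ hf one_pos
  set r := √(∫ z, ‖penalizedLSE Θ f (θ₀ + z) - θ₀‖ ^ 2
    ∂stdGaussian (EuclideanSpace ℝ (Fin n)))
  have hrisk : ∫ z, ‖penalizedLSE Θ f (θ₀ + z) - θ₀‖ ^ 2
      ∂stdGaussian (EuclideanSpace ℝ (Fin n)) = r ^ 2 :=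
    (sq_sqrt (integral_nonneg fun z ↦ by positivity)).symm
  have hr0 : 0 ≤ r := sqrt_nonneg _
  obtain ⟨θ, hθ, hle⟩ :
      ∃ θ ∈ Θ, ENNReal.ofReal (1 / 5000) * risk (penalizedLSE Θ f) θ ≤ risk δ θ := by
    rcases hr0.eq_or_lt with h0 | hpos
    · refine ⟨θ₀, hθ₀, ?_⟩
      rw [hT.risk_eq_ofReal_integral, hrisk, ← h0]
      simp
    · obtain ⟨θ, hθ, hlt⟩ := (le_total r 20).elim
        (exists_mul_risk_lt_of_le hΘ.2.1 hT hTΘ hδ hθ₀ hpos · hrisk)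
        (exists_mul_risk_lt_of_ge hΘ.2.1 hT hTΘ hδ hθ₀ hbias · hrisk)
      exact ⟨θ, hθ, hlt.le⟩
  refine le_iSup₂_of_le θ hθ (le_riskRatio ?_ (hT.risk_ne_top θ) hle)
  rw [ENNReal.ofReal_le_one]
  norm_num

theorem le_Cstar : ENNReal.ofReal (1 / 5000) ≤ Cstar :=
  le_iInf₂ fun _ _ ↦ le_iInf₂ fun _ hΘ ↦ le_iInf₂ fun _ hf ↦ le_normalizedMinimaxRisk hΘ hf

end LowerBound

section UpperBound

lemma lintegral_stdGaussian_neg {E : Type*} [NormedAddCommGroup E] [InnerProductSpace ℝ E]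
    [FiniteDimensional ℝ E] [MeasurableSpace E] [BorelSpace E] {g : E → ℝ≥0∞}
    (hg : Measurable g) : ∫⁻ z, g (-z) ∂stdGaussian E = ∫⁻ z, g z ∂stdGaussian E := by
  conv_rhs => rw [← stdGaussian_map (LinearIsometryEquiv.neg ℝ (E := E))]
  rw [lintegral_map hg (by fun_prop)]
  rfl

lemma ofReal_two_mul (c : ℝ) : ENNReal.ofReal (2 * c) = 2 * ENNReal.ofReal c := by
  rw [ENNReal.ofReal_mul zero_le_two, ENNReal.ofReal_ofNat]

lemma mul_measure_le_risk {n : ℕ} {δ : EuclideanSpace ℝ (Fin n) → EuclideanSpace ℝ (Fin n)}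
    (hδ : Measurable δ) (θ : EuclideanSpace ℝ (Fin n)) {S : Set (EuclideanSpace ℝ (Fin n))}
    (hS : MeasurableSet S) {c : ℝ}
    (hc : ∀ z ∈ S, 2 * c ≤ ‖δ (θ + z) - θ‖ ^ 2 + ‖δ (θ + -z) - θ‖ ^ 2) :
    ENNReal.ofReal c * stdGaussian (EuclideanSpace ℝ (Fin n)) S ≤ risk δ θ := by
  set loss := fun z ↦ ENNReal.ofReal (‖δ (θ + z) - θ‖ ^ 2)
  have hm : Measurable loss := by fun_prop
  have hpt (z) (hz : z ∈ S) : 2 * ENNReal.ofReal c ≤ loss z + loss (-z) := by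
    rw [← ofReal_two_mul, ← ENNReal.ofReal_add (by positivity) (by positivity)]
    exact ENNReal.ofReal_le_ofReal (hc z hz)
  refine (ENNReal.mul_le_mul_iff_right two_ne_zero ENNReal.ofNat_ne_top).1 ?_
  calc 2 * (ENNReal.ofReal c * stdGaussian (EuclideanSpace ℝ (Fin n)) S)
      = ∫⁻ _ in S, 2 * ENNReal.ofReal c ∂stdGaussian (EuclideanSpace ℝ (Fin n)) := by
        rw [setLIntegral_const, mul_assoc]
    _ ≤ ∫⁻ z in S, (loss z + loss (-z)) ∂stdGaussian (EuclideanSpace ℝ (Fin n)) :=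
        setLIntegral_mono' hS hpt
    _ ≤ ∫⁻ z, (loss z + loss (-z)) ∂stdGaussian (EuclideanSpace ℝ (Fin n)) :=
        setLIntegral_le_lintegral _ _
    _ = 2 * risk δ θ := by
        rw [lintegral_add_left hm, lintegral_stdGaussian_neg hm, ← risk_eq_lintegral hδ, two_mul]

lemma closedBall_mem_parameterSets {n : ℕ} {a : ℝ} (ha : 0 ≤ a) :
    Metric.closedBall (0 : EuclideanSpace ℝ (Fin n)) a ∈ parameterSets n :=
  ⟨Metric.isClosed_closedBall, convex_closedBall 0 a, Metric.nonempty_closedBall.2 ha⟩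

lemma const_mem_penalties_of_isCompact {n : ℕ} {Θ : Set (EuclideanSpace ℝ (Fin n))}
    (hcompact : IsCompact Θ) (hconvex : Convex ℝ Θ) (hne : Θ.Nonempty) (c : ℝ) :
    (fun _ ↦ c) ∈ penalties Θ := by
  refine ⟨convexOn_const c hconvex, ⟨c, ?_⟩, fun x ↦ ?_⟩
  · rintro _ ⟨y, -, rfl⟩
    exact le_rfl
  · obtain ⟨b, hb, hmin⟩ := hcompact.exists_isMinOn hne
      (f := fun α ↦ 1 / 2 * ‖x - α‖ ^ 2 + c) (by fun_prop)
    exact ⟨b, hb, hmin⟩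

lemma zero_mem_penalties_closedBall {n : ℕ} {a : ℝ} (ha : 0 ≤ a) :
    (fun _ ↦ 0) ∈ penalties (Metric.closedBall (0 : EuclideanSpace ℝ (Fin n)) a) :=
  const_mem_penalties_of_isCompact (isCompact_closedBall 0 a) (convex_closedBall 0 a)
    (Metric.nonempty_closedBall.2 ha) 0

/-- The least squares estimator over the interval `[-a, a]`, a subset of the one-dimensional
Euclidean space. -/
noncomputable def intervalLSE (a : ℝ) : EuclideanSpace ℝ (Fin 1) → EuclideanSpace ℝ (Fin 1) :=
  penalizedLSE (Metric.closedBall (0 : EuclideanSpace ℝ (Fin 1)) a) (fun _ ↦ 0)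

lemma norm_eq_abs_apply_zero (x : EuclideanSpace ℝ (Fin 1)) : ‖x‖ = |x 0| := by
  rw [EuclideanSpace.norm_eq]
  simp [sqrt_sq_eq_abs]

lemma intervalLSE_apply_zero {a : ℝ} (ha : 0 ≤ a) (x : EuclideanSpace ℝ (Fin 1)) :
    intervalLSE a x 0 = max (-a) (min a (x 0)) := by
  have hf := zero_mem_penalties_closedBall (n := 1) ha
  set p := intervalLSE a x 0
  set c := max (-a) (min a (x 0))
  have hp : -a ≤ p ∧ p ≤ a := by
    have hmem := penalizedLSE_mem hf x
    rwa [mem_closedBall_zero_iff, norm_eq_abs_apply_zero, abs_le] at hmem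
  have hc : |c| ≤ a := abs_le.2 ⟨le_max_left _ _, max_le (by linarith) (min_le_left _ _)⟩
  have hvar : (x 0 - p) * (c - p) ≤ 0 := by
    have h := (isPenalizedMin_penalizedLSE hf x).inner_le hf.1 (α := WithLp.toLp 2 fun _ ↦ c)
      (by simpa [norm_eq_abs_apply_zero] using hc)
    simp only [PiLp.inner_apply, Fin.sum_univ_one, PiLp.sub_apply, sub_self] at h
    simpa [p, intervalLSE, mul_comm] using h
  have hclip : (x 0 - c) * (p - c) ≤ 0 := by
    rcases min_cases a (x 0) with ⟨hmin, hle⟩ | ⟨hmin, -⟩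
    · have hca : c = a := by simp only [c, hmin]; exact max_eq_right (by linarith)
      rw [hca]
      exact mul_nonpos_of_nonneg_of_nonpos (by linarith) (by linarith)
    · rcases le_total (-a) (x 0) with hax | hax
      · have hcx : c = x 0 := by simp only [c, hmin]; exact max_eq_right hax
        rw [hcx, sub_self, zero_mul]
      · have hca : c = -a := by simp only [c, hmin]; exact max_eq_left hax
        rw [hca]
        exact mul_nonpos_of_nonpos_of_nonneg (by linarith) (by linarith)
  nlinarith

lemma sq_norm_intervalLSE_sub_add {a : ℝ} (ha : 0 ≤ a) {θ z : EuclideanSpace ℝ (Fin 1)}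
    (hθ : ‖θ‖ ≤ a) (hz : 2 * a < ‖z‖) :
    ‖intervalLSE a (θ + z) - θ‖ ^ 2 + ‖intervalLSE a (θ + -z) - θ‖ ^ 2 =
      2 * (a ^ 2 + ‖θ‖ ^ 2) := by
  simp only [norm_eq_abs_apply_zero, sq_abs, PiLp.sub_apply, PiLp.add_apply, PiLp.neg_apply,
    intervalLSE_apply_zero ha] at *
  grind

lemma riskRatio_le_inv {a b k : ℝ≥0∞} (hb : b ≠ 0) (hk0 : k ≠ 0) (hk : k ≠ ∞) (h : k * a ≤ b) :
    riskRatio a b ≤ k⁻¹ := by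
  rw [riskRatio, if_neg (by tauto)]
  refine ENNReal.div_le_of_le_mul ?_
  rwa [mul_comm, ← div_eq_mul_inv, ENNReal.le_div_iff_mul_le (.inl hk0) (.inl hk), mul_comm]

lemma normalizedMinimaxRisk_closedBall_le {a : ℝ} (ha : 0 < a)
    (hγ : stdGaussian (EuclideanSpace ℝ (Fin 1)) (Metric.closedBall 0 (2 * a))ᶜ ≠ 0) :
    normalizedMinimaxRisk (Metric.closedBall (0 : EuclideanSpace ℝ (Fin 1)) a) (fun _ ↦ 0) ≤
      (2 * stdGaussian (EuclideanSpace ℝ (Fin 1)) (Metric.closedBall 0 (2 * a))ᶜ)⁻¹ := by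
  set q := stdGaussian (EuclideanSpace ℝ (Fin 1)) (Metric.closedBall 0 (2 * a))ᶜ
  refine iInf₂_le_of_le (fun _ ↦ 0) measurable_const (iSup₂_le fun θ hθ ↦ ?_)
  rw [mem_closedBall_zero_iff] at hθ
  have hm : Measurable (intervalLSE a) :=
    (isFirmlyNonexpansive_penalizedLSE
      (zero_mem_penalties_closedBall ha.le)).lipschitzWith.continuous.measurable
  have hle : ENNReal.ofReal (a ^ 2 + ‖θ‖ ^ 2) * q ≤ risk (intervalLSE a) θ :=
    mul_measure_le_risk hm θ Metric.isClosed_closedBall.measurableSet.compl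
      fun z hz ↦ (sq_norm_intervalLSE_sub_add ha.le hθ (by simpa using hz)).ge
  have hpos : 0 < ENNReal.ofReal (a ^ 2 + ‖θ‖ ^ 2) * q :=
    ENNReal.mul_pos (ENNReal.ofReal_pos.2 (by positivity)).ne' hγ
  have hzero : risk (fun _ ↦ 0) θ = ENNReal.ofReal (‖θ‖ ^ 2) := by
    rw [risk_eq_lintegral measurable_const]
    simp
  refine riskRatio_le_inv (b := risk (intervalLSE a) θ) (hpos.trans_le hle).ne'
    (by simpa using hγ) (ENNReal.mul_ne_top ENNReal.ofNat_ne_top (measure_ne_top _ _)) ?_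
  refine le_trans ?_ hle
  rw [hzero, mul_right_comm, ← ofReal_two_mul]
  have hsq : ‖θ‖ ^ 2 ≤ a ^ 2 := by gcongr
  gcongr
  linarith

lemma tendsto_measure_compl_closedBall {E : Type*} [NormedAddCommGroup E] [MeasurableSpace E]
    [BorelSpace E] (μ : Measure E) [IsProbabilityMeasure μ] [NullSingletonClass μ] :
    Filter.Tendsto (fun r ↦ μ (Metric.closedBall 0 r)ᶜ) (nhdsWithin 0 (Set.Ioi 0)) (nhds 1) := by
  have hball : Filter.Tendsto (fun r ↦ μ (Metric.cthickening r {0})) (nhds 0) (nhds 0) := by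
    simpa using tendsto_measure_cthickening_of_isClosed (μ := μ) (s := {0})
      ⟨1, one_pos, measure_ne_top _ _⟩ isClosed_singleton
  have hcompl := ENNReal.Tendsto.sub (tendsto_const_nhds (x := (1 : ℝ≥0∞)))
    (hball.mono_left (nhdsWithin_le_nhds (s := Set.Ioi 0))) (.inl ENNReal.one_ne_top)
  rw [tsub_zero] at hcompl
  refine hcompl.congr' (Filter.eventually_of_mem self_mem_nhdsWithin fun r hr ↦ ?_)
  rw [Metric.cthickening_singleton _ (Set.mem_Ioi.1 hr).le,
    ← prob_compl_eq_one_sub Metric.isClosed_closedBall.measurableSet]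

theorem Cstar_le_half : Cstar ≤ 1 / 2 := by
  have : NullSingletonClass (stdGaussian (EuclideanSpace ℝ (Fin 1))) :=
    ⟨fun x ↦ stdGaussian_absolutelyContinuous (measure_singleton x)⟩
  have hmass := tendsto_measure_compl_closedBall (stdGaussian (EuclideanSpace ℝ (Fin 1)))
  have hlim : Filter.Tendsto
      (fun r ↦ (2 * stdGaussian (EuclideanSpace ℝ (Fin 1)) (Metric.closedBall 0 r)ᶜ)⁻¹)
      (nhdsWithin 0 (Set.Ioi 0)) (nhds (1 / 2)) := by
    have hdouble := ENNReal.Tendsto.const_mul hmass (.inr (ENNReal.ofNat_ne_top (n := 2)))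
    rw [mul_one] at hdouble
    rw [one_div]
    exact hdouble.inv
  refine ge_of_tendsto hlim ?_
  filter_upwards [self_mem_nhdsWithin, hmass.eventually_ne one_ne_zero] with r hr hpos
  obtain ⟨a, rfl⟩ : ∃ a, r = 2 * a := ⟨r / 2, by ring⟩
  have ha : 0 < a := pos_of_mul_pos_right (Set.mem_Ioi.1 hr) zero_le_two
  exact iInf₂_le_of_le 1 le_rfl (iInf₂_le_of_le _ (closedBall_mem_parameterSets ha.le)
    (iInf₂_le_of_le _ (zero_mem_penalties_closedBall ha.le)
      (normalizedMinimaxRisk_closedBall_le ha hpos)))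

end UpperBound

end GaussianSequence

theorem theorem3_general :
    ENNReal.ofReal (1 / 5000) ≤ GaussianSequence.Cstar ∧ GaussianSequence.Cstar ≤ 1 / 2 :=
  ⟨GaussianSequence.le_Cstar, GaussianSequence.Cstar_le_half⟩

theorem theorem3 :
    ENNReal.ofReal (6.05 * 10 ^ (-6 : ℤ)) ≤ GaussianSequence.Cstar ∧
      GaussianSequence.Cstar ≤ 1 / 2 :=
  theorem3_general.imp_left (ENNReal.ofReal_le_ofReal (by norm_num)).trans
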